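/- For all constants $K>0$ and $\kappa>1$ there are constants $C_1,C_2,C>0$, depending only on $K$ and $\kappa$, such that the following holds. Let $m,n,k$ be natural numbers, $r>0$, $L\ge 0$, let $\mathbb{B}^k(r)=\{z\in\mathbb{R}^k:\|z\|_2\le r\}$, and let $G:\mathbb{B}^k(r)\to\mathbb{S}^{n-1}$ be $L$-Lipschitz for the Euclidean norms. Assume $Lrn\ge\kappa$ and $m\le Kn$. Let $x\in G(\mathbb{B}^k(r))$, let $A_1,\dots,A_m\in\mathbb{R}^{n\times n}$ be independent random matrices with i.i.d. standard normal entries, and put $$y_i=x^\top A_ix,\qquad S_{in}=\frac1m\sum_{i=1}^m y_iA_i,\qquad \widetilde S_{in}=\frac12\big(S_{in}+S_{in}^\top\big).$$ Let $w_0\in\mathbb{R}^n$ be a fixed (deterministic) vector with $\|w_0\|_2=1$ and $x^\top w_0>c_0$ for some $c_0>0$. If $m\ge C_1k\log(Lrn)$, then with probability at least $1-\exp(-C_2k\log(Lrn))$, every output $\hat w=\mathcal{P}_G(\widetilde S_{in}w_0)$ of the projected power method, i.e. every point $\hat w$ of $G(\mathbb{B}^k(r))$ closest to $\widetilde S_{in}w_0$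 in the Euclidean norm, satisfies $$\|\hat w-x\|_2\le\frac{C}{c_0}\sqrt{\frac{k\log(nLr)}{m}}.$$ -/

import Mathlib

open MeasureTheory ProbabilityTheory
open scoped NNReal Matrix

namespace QuadSystem

/-- The entries of the `m` random `n × n` matrices `A 0, …, A (m - 1)` are independent standard
normal random variables (jointly over all matrices and all entries). -/
structure IsIIDGaussian {Ω : Type*} [MeasurableSpace Ω] (P : Measure Ω) {m n : ℕ}
    (A : Fin m → Ω → Matrix (Fin n) (Fin n) ℝ) : Prop where
  hasLaw : ∀ i j l, HasLaw (fun ω => A i ω j l) (gaussianReal 0 1) P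
  indep : iIndepFun (fun (p : Fin m × Fin n × Fin n) (ω : Ω) => A p.1 ω p.2.1 p.2.2) P

/-- The `i`-th quadratic measurement `y_i = xᵀ A_i x`. -/
noncomputable def meas {m n : ℕ} (A : Fin m → Matrix (Fin n) (Fin n) ℝ)
    (x : EuclideanSpace ℝ (Fin n)) (i : Fin m) : ℝ :=
  x.ofLp ⬝ᵥ (A i *ᵥ x.ofLp)

/-- `S_in = (1/m) ∑ y_i A_i`, for given data `(A_i, y_i)`. -/
noncomputable def dataMatrix {m n : ℕ} (A : Fin m → Matrix (Fin n) (Fin n) ℝ)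
    (y : Fin m → ℝ) : Matrix (Fin n) (Fin n) ℝ :=
  (1 / (m : ℝ)) • ∑ i, y i • A i

/-- The symmetrization `(S_in + S_inᵀ) / 2` of the data matrix. -/
noncomputable def symDataMatrix {m n : ℕ} (A : Fin m → Matrix (Fin n) (Fin n) ℝ)
    (y : Fin m → ℝ) : Matrix (Fin n) (Fin n) ℝ :=
  (1 / 2 : ℝ) • (dataMatrix A y + (dataMatrix A y)ᵀ)

/-- The set of Euclidean projections of `z` onto `K`, i.e. of the points of `K` closest to `z`
(`K` need not be convex, so there may be several). -/
def projections {n : ℕ} (K : Set (EuclideanSpace ℝ (Fin n))) (z : EuclideanSpace ℝ (Fin n)) :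
    Set (EuclideanSpace ℝ (Fin n)) :=
  {w | w ∈ K ∧ ∀ s ∈ K, ‖z - w‖ ≤ ‖z - s‖}

/-- A projection onto a nonempty compact set exists. -/
theorem projections_nonempty {n : ℕ} {K : Set (EuclideanSpace ℝ (Fin n))} (hK : IsCompact K)
    (hne : K.Nonempty) (z : EuclideanSpace ℝ (Fin n)) : (projections K z).Nonempty := by
  obtain ⟨w, hw, hmin⟩ := hK.exists_isMinOn hne
    (f := fun s => ‖z - s‖) (by fun_prop)
  exact ⟨w, hw, fun s hs => hmin hs⟩

/-- The possible outputs of one step of the projected power method from `w₀`, with data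
`(A_i, y_i)` and generative model `G` on the closed ball of radius `r` about the origin. -/
noncomputable def powerStep {m n k : ℕ} (A : Fin m → Matrix (Fin n) (Fin n) ℝ) (y : Fin m → ℝ)
    (G : EuclideanSpace ℝ (Fin k) → EuclideanSpace ℝ (Fin n)) (r : ℝ)
    (w₀ : EuclideanSpace ℝ (Fin n)) : Set (EuclideanSpace ℝ (Fin n)) :=
  projections (G '' Metric.closedBall 0 r) (WithLp.toLp 2 (symDataMatrix A y *ᵥ w₀.ofLp))

end QuadSystem

/-! ### Nets of balls and Bernstein's inequality. -/

namespace QuadSystem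

/-! Let `e` be the deviation of `S̃ w₀` from its mean `⟪x, w₀⟫ x`, and put `ℓ = k log(Lrn)`, `ε =
√(ℓ/m)`, `h = ‖ŵ - x‖`. As `ŵ` and `x` are unit vectors and `ŵ` is the closer to `S̃ w₀`,
`sq_norm_sub_le_of_mem_projections` gives `c₀ h² / 2 ≤ ⟪e, ŵ - x⟫`.

For fixed `v`, `⟪e, v⟫` is a centred average of products of two Gaussian linear forms, so it has
Bernstein tails (`tail_inner_symDataMatrix`). Two union bounds follow. A net of the parameter ball,
with image mesh `1/n` and about `(Lrn)^k` points, gives `|⟪e, x - G z'⟫| ≤ B ε ‖x - G z'‖` on the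
net. A `1/2`-net of the unit ball of `ℝⁿ` gives the crude bound `‖e‖ ≲ n/m`.

Moving `ŵ` to its net point then costs only `(n/m)(1/n) = 1/m ≲ ε²`, so a single scale suffices and
no chaining is needed. Hence `c₀ h² / 2 ≤ B ε h + D ε²`, and `le_div_mul_of_quadratic_le` concludes.
-/

/-- Volumetric bound for separated subsets of a ball. -/
theorem card_le_of_separated_of_norm_le {E : Type*} [NormedAddCommGroup E] [NormedSpace ℝ E]
    [FiniteDimensional ℝ E] {r δ : ℝ} (hr : 0 < r) (hδ : 0 < δ) (s : Finset E)
    (hs : ∀ c ∈ s, ‖c‖ ≤ r) (h : ∀ c ∈ s, ∀ d ∈ s, c ≠ d → δ ≤ ‖c - d‖) :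
    (s.card : ℝ) ≤ (1 + 2 * r / δ) ^ Module.finrank ℝ E := by
  borelize E
  let μ : Measure E := Measure.addHaar
  set N := Module.finrank ℝ E
  have hρ : 0 < r + δ / 2 := by positivity
  have hD : Set.Pairwise (s : Set E)
      (Function.onFun Disjoint fun c => Metric.ball (c : E) (δ / 2)) := by
    rintro c hc d hd hcd
    apply Metric.ball_disjoint_ball
    rw [dist_eq_norm]
    have := h c hc d hd hcd
    linarith
  have hsub : (⋃ c ∈ s, Metric.ball (c : E) (δ / 2)) ⊆ Metric.ball 0 (r + δ / 2) := by
    refine Set.iUnion₂_subset fun c hc => Metric.ball_subset_ball' ?_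
    rw [dist_zero_right]
    linarith [hs c hc]
  have hI : (s.card : ENNReal) * ENNReal.ofReal ((δ / 2) ^ N) * μ (Metric.ball 0 1) ≤
      ENNReal.ofReal ((r + δ / 2) ^ N) * μ (Metric.ball 0 1) :=
    calc
      _ = μ (⋃ c ∈ s, Metric.ball (c : E) (δ / 2)) := by
        rw [measure_biUnion_finset hD fun c _ => measurableSet_ball]
        simp only [μ.addHaar_ball_of_pos _ (half_pos hδ), Finset.sum_const, nsmul_eq_mul,
          mul_assoc, N]
      _ ≤ μ (Metric.ball (0 : E) (r + δ / 2)) := measure_mono hsub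
      _ = _ := by rw [μ.addHaar_ball_of_pos _ hρ]
  have hJ := (ENNReal.mul_le_mul_iff_left
    (Metric.measure_ball_pos _ _ zero_lt_one).ne' measure_ball_lt_top.ne).1 hI
  have hK := ENNReal.toReal_le_of_le_ofReal (pow_nonneg hρ.le _) hJ
  rw [ENNReal.toReal_mul, ENNReal.toReal_natCast, ENNReal.toReal_ofReal (by positivity),
    ← le_div_iff₀ (by positivity), ← div_pow] at hK
  have hr' : (r + δ / 2) / (δ / 2) = 1 + 2 * r / δ := by field_simp; ring
  rwa [hr'] at hK

/-- Finite nets of balls of cardinality given by the volumetric bound. -/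
theorem exists_net_closedBall {E : Type*} [NormedAddCommGroup E] [NormedSpace ℝ E]
    [FiniteDimensional ℝ E] {r δ : ℝ} (hr : 0 < r) (hδ : 0 < δ) :
    ∃ s : Finset E, (∀ c ∈ s, ‖c‖ ≤ r) ∧ (∀ z : E, ‖z‖ ≤ r → ∃ c ∈ s, ‖z - c‖ ≤ δ) ∧
      (s.card : ℝ) ≤ (1 + 2 * r / δ) ^ Module.finrank ℝ E := by
  classical
  -- A separated set of maximal cardinality is a net: an uncovered point could be added to it. The
  -- volumetric bound makes the maximum exist.
  let Q : ℕ → Prop := fun N => ∃ s : Finset E, s.card = N ∧ (∀ c ∈ s, ‖c‖ ≤ r) ∧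
    ∀ c ∈ s, ∀ d ∈ s, c ≠ d → δ ≤ ‖c - d‖
  have hbd : ∀ N, Q N → N ≤ ⌊(1 + 2 * r / δ) ^ Module.finrank ℝ E⌋₊ := by
    rintro N ⟨s, rfl, hs, h⟩
    exact Nat.le_floor (card_le_of_separated_of_norm_le hr hδ s hs h)
  have h0 : Q 0 := ⟨∅, by simp, by simp, by simp⟩
  obtain ⟨s, hcard, hs, hsep⟩ := Nat.findGreatest_spec (P := Q) (Nat.zero_le _) h0
  refine ⟨s, hs, fun z hz => ?_, card_le_of_separated_of_norm_le hr hδ s hs hsep⟩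
  by_contra! hcon
  have hzs : z ∉ s := fun hmem => by
    have := hcon z hmem
    simp only [sub_self, norm_zero] at this
    linarith
  have hQ : Q (insert z s).card := by
    refine ⟨_, rfl, ?_, ?_⟩
    · simpa using ⟨hz, hs⟩
    · intro c hc d hd hcd
      rcases Finset.mem_insert.1 hc with hc' | hc' <;> rcases Finset.mem_insert.1 hd with hd' | hd'
      · exact absurd (hc'.trans hd'.symm) hcd
      · rw [hc']; exact (hcon d hd').le
      · rw [hd', norm_sub_rev]; exact (hcon c hc').le
      · exact hsep c hc' d hd' hcd
  have hle := Nat.le_findGreatest (hbd _ hQ) hQ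
  rw [Finset.card_insert_of_notMem hzs, hcard] at hle
  exact absurd hle (Nat.not_succ_le_self _)

/-- Taylor remainder of order two. Keeping the linear term exact lets the mean appear exactly in the
moment generating function. -/
theorem exp_le_one_add_add_sq_mul_exp_abs (u : ℝ) :
    Real.exp u ≤ 1 + u + u ^ 2 * Real.exp |u| := by
  have h := Complex.norm_exp_sub_sum_le_norm_mul_exp (u : ℂ) 2
  rw [Finset.sum_range_succ, Finset.sum_range_one] at h
  simp only [pow_zero, Nat.factorial_zero, Nat.cast_one, div_one, pow_one, Nat.factorial_one] at h
  norm_cast at h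
  simp only [Real.norm_eq_abs, sq_abs] at h
  linarith [le_abs_self (Real.exp u - (1 + u))]

/-- A moment generating function bound near the origin under exponential integrability. -/
theorem mgf_le_exp_of_integral_exp_abs_le {Ω : Type*} [MeasurableSpace Ω] {P : Measure Ω}
    [IsProbabilityMeasure P] {ξ : Ω → ℝ} {M a t : ℝ} (hξ : AEMeasurable ξ P)
    (hint : Integrable (fun ω => Real.exp (|ξ ω| / 8)) P)
    (hM : ∫ ω, Real.exp (|ξ ω| / 8) ∂P ≤ M) (ha : ∫ ω, ξ ω ∂P = a) (ht : |t| ≤ 1 / 16) :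
    Integrable (fun ω => Real.exp (t * ξ ω)) P ∧
      mgf ξ P t ≤ Real.exp (t * a + 512 * M * t ^ 2) := by
  have hI : Integrable ξ P := by
    refine (hint.const_mul 8).mono hξ.aestronglyMeasurable (ae_of_all _ fun ω => ?_)
    rw [Real.norm_eq_abs, Real.norm_of_nonneg (by positivity)]
    linarith [Real.add_one_le_exp (|ξ ω| / 8)]
  have hE : Integrable (fun ω => Real.exp (t * ξ ω)) P := by
    refine hint.mono (by fun_prop) (ae_of_all _ fun ω => ?_)
    rw [Real.norm_of_nonneg (by positivity), Real.norm_of_nonneg (by positivity)]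
    refine Real.exp_le_exp.2 ((le_abs_self _).trans ?_)
    rw [abs_mul]
    nlinarith [abs_nonneg (ξ ω)]
  refine ⟨hE, ?_⟩
  have hpt : ∀ ω, Real.exp (t * ξ ω) ≤
      1 + t * ξ ω + 512 * t ^ 2 * Real.exp (|ξ ω| / 8) := by
    intro ω
    refine (exp_le_one_add_add_sq_mul_exp_abs _).trans ?_
    have h1 : Real.exp |t * ξ ω| ≤ Real.exp (|ξ ω| / 16) := by
      refine Real.exp_le_exp.2 ?_
      rw [abs_mul]
      nlinarith [abs_nonneg (ξ ω)]
    -- `u² / 2 ≤ exp u` at `u = |ξ| / 16`, whence `512 = 2 · 16²`. Half of the available exponent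
    -- `1/8` pays for `ξ²`, the other half for `exp |t ξ|`.
    have h2 : (ξ ω) ^ 2 ≤ 512 * Real.exp (|ξ ω| / 16) := by
      have := Real.quadratic_le_exp_of_nonneg (x := |ξ ω| / 16) (by positivity)
      have h3 : (|ξ ω| / 16) ^ 2 = (ξ ω) ^ 2 / 256 := by rw [div_pow, sq_abs]; norm_num
      rw [h3] at this
      have := abs_nonneg (ξ ω)
      linarith
    have h4 : Real.exp (|ξ ω| / 8) = Real.exp (|ξ ω| / 16) * Real.exp (|ξ ω| / 16) := by
      rw [← Real.exp_add]; ring_nf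
    have h5 : (t * ξ ω) ^ 2 * Real.exp |t * ξ ω| ≤
        t ^ 2 * (512 * Real.exp (|ξ ω| / 16)) * Real.exp (|ξ ω| / 16) := by
      rw [mul_pow]; gcongr
    rw [h4]
    linarith
  calc mgf ξ P t ≤ ∫ ω, (1 + t * ξ ω + 512 * t ^ 2 * Real.exp (|ξ ω| / 8)) ∂P :=
        integral_mono hE (((integrable_const _).add (hI.const_mul t)).add (hint.const_mul _)) hpt
    _ = 1 + t * a + 512 * t ^ 2 * ∫ ω, Real.exp (|ξ ω| / 8) ∂P := by
        have h1 : Integrable (fun ω => 1 + t * ξ ω) P := (integrable_const _).add (hI.const_mul t)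
        rw [integral_add h1 (hint.const_mul _),
          integral_add (integrable_const _) (hI.const_mul t), integral_const_mul,
          integral_const_mul, ha]
        simp
    _ ≤ 1 + t * a + 512 * t ^ 2 * M := by gcongr
    _ ≤ _ := by linarith [Real.add_one_le_exp (t * a + 512 * M * t ^ 2)]

/-- One-sided Bernstein inequality for sums of independent subexponential variables. -/
theorem bernstein_upper_tail {Ω : Type*} [MeasurableSpace Ω] {P : Measure Ω}
    [IsProbabilityMeasure P] {m : ℕ} {ξ : Fin m → Ω → ℝ} {M a t : ℝ}
    (hind : iIndepFun ξ P) (hξ : ∀ i, AEMeasurable (ξ i) P)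
    (hint : ∀ i, Integrable (fun ω => Real.exp (|ξ i ω| / 8)) P)
    (hM0 : 0 ≤ M)
    (hM : ∀ i, ∫ ω, Real.exp (|ξ i ω| / 8) ∂P ≤ M) (ha : ∀ i, ∫ ω, ξ i ω ∂P = a) (ht : 0 ≤ t) :
    P.real {ω | m * (a + t) ≤ ∑ i, ξ i ω} ≤
      Real.exp (-(m * min t (t ^ 2) / (2 * (16 + 1024 * M)))) := by
  set q : ℝ := 16 + 1024 * M with hq
  have hq16 : 16 ≤ q := by linarith
  -- Nearly optimal Chernoff parameter: the `16` in `q` keeps `s ≤ 1/16`, and the `1024 * M` makes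
  -- the quadratic term at most half of the linear gain.
  set s := min t 1 / q with hs
  have hs0 : 0 ≤ s := by positivity
  have hs1 : |s| ≤ 1 / 16 := by
    rw [abs_of_nonneg hs0, hs]
    exact div_le_div₀ (by norm_num) (min_le_right _ _) (by norm_num) hq16
  have hmgf := fun i => mgf_le_exp_of_integral_exp_abs_le (hξ i) (hint i) (hM i) (ha i) hs1
  have hsum : mgf (∑ i, ξ i) P s ≤ Real.exp (m * (s * a + 512 * M * s ^ 2)) := by
    rw [hind.mgf_sum₀ hξ]
    calc ∏ i, mgf (ξ i) P s ≤ ∏ _i : Fin m, Real.exp (s * a + 512 * M * s ^ 2) :=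
          Finset.prod_le_prod (fun _ _ => mgf_nonneg) fun i _ => (hmgf i).2
      _ = _ := by rw [Finset.prod_const, Finset.card_univ, Fintype.card_fin, ← Real.exp_nat_mul]
  have hI : Integrable (fun ω => Real.exp (s * (∑ i, ξ i) ω)) P :=
    by
    -- Without integrability the mgf would take its default value `0`, but it is a product of
    -- positive factors.
    by_contra hcon
    have h0 := mgf_undef hcon
    rw [hind.mgf_sum₀ hξ] at h0
    exact (Finset.prod_pos fun i _ => mgf_pos (hmgf i).1).ne' h0
  have hch := measure_ge_le_exp_mul_mgf (μ := P) (X := ∑ i, ξ i) (m * (a + t)) hs0 hI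
  simp only [Finset.sum_apply] at hch
  refine hch.trans ?_
  calc Real.exp (-s * (m * (a + t))) * mgf (∑ i, ξ i) P s
      ≤ Real.exp (-s * (m * (a + t))) * Real.exp (m * (s * a + 512 * M * s ^ 2)) := by gcongr
    _ = Real.exp (m * (512 * M * s ^ 2 - s * t)) := by rw [← Real.exp_add]; ring_nf
    _ ≤ _ := by
      refine Real.exp_le_exp.2 ?_
      have key : 512 * M * s ^ 2 - s * t ≤ -(min t (t ^ 2) / (2 * q)) := by
        have hqpos : 0 < q := by linarith
        have h1 : 512 * M * s ^ 2 ≤ (min t 1) ^ 2 / (2 * q) := by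
          rw [hs, div_pow, mul_div_assoc', div_le_div_iff₀ (by positivity) (by positivity)]
          nlinarith [mul_nonneg (sq_nonneg (min t 1)) hqpos.le]
        have h2 : s * t = 2 * (min t 1 * t) / (2 * q) := by rw [hs]; field_simp
        have h3 : (min t 1) ^ 2 + min t (t ^ 2) ≤ 2 * (min t 1 * t) := by
          rcases le_total t 1 with h | h
          · rw [min_eq_left h, min_eq_right (by nlinarith)]; nlinarith
          · rw [min_eq_right h, min_eq_left (by nlinarith)]; nlinarith
        rw [h2]
        have := div_le_div_of_nonneg_right h3 (by positivity : (0:ℝ) ≤ 2 * q)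
        rw [add_div] at this
        linarith
      have := mul_le_mul_of_nonneg_left key (Nat.cast_nonneg (α := ℝ) m)
      calc _ ≤ _ := this
        _ = _ := by ring

/-- Two-sided Bernstein inequality for sums of independent subexponential variables. -/
theorem bernstein_tail {Ω : Type*} [MeasurableSpace Ω] {P : Measure Ω}
    [IsProbabilityMeasure P] {m : ℕ} {ξ : Fin m → Ω → ℝ} {M a t : ℝ}
    (hind : iIndepFun ξ P) (hξ : ∀ i, AEMeasurable (ξ i) P)
    (hint : ∀ i, Integrable (fun ω => Real.exp (|ξ i ω| / 8)) P)
    (hM0 : 0 ≤ M)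
    (hM : ∀ i, ∫ ω, Real.exp (|ξ i ω| / 8) ∂P ≤ M) (ha : ∀ i, ∫ ω, ξ i ω ∂P = a) (ht : 0 ≤ t) :
    P.real {ω | m * t ≤ |∑ i, ξ i ω - m * a|} ≤
      2 * Real.exp (-(m * min t (t ^ 2) / (2 * (16 + 1024 * M)))) := by
  have h1 := bernstein_upper_tail hind hξ hint hM0 hM ha ht
  have h2 := bernstein_upper_tail (ξ := fun i ω => -ξ i ω) (a := -a)
    (hind.comp (fun _ x => -x) fun _ => measurable_neg) (fun i => (hξ i).neg)
    (by simpa using hint) hM0 (by simpa using hM) (by simpa [integral_neg] using ha) ht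
  calc _ ≤ P.real ({ω | m * (a + t) ≤ ∑ i, ξ i ω} ∪ {ω | m * (-a + t) ≤ ∑ i, -ξ i ω}) := by
        refine measureReal_mono fun ω hω => ?_
        simp only [Set.mem_ofPred_eq, Set.mem_union, Finset.sum_neg_distrib] at hω ⊢
        rcases le_abs.1 hω with h | h
        · left; linarith
        · right; linarith
    _ ≤ _ := (measureReal_union_le _ _).trans (by linarith)

end QuadSystem

/-! ### Gaussian linear forms and concentration of the data matrix. -/

namespace QuadSystem

/-- The exponential moment `𝔼 exp (g² / 8)` of a standard normal variable `g`. -/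
noncomputable def gaussSqExpMoment : ℝ := ∫ x, Real.exp (x ^ 2 / 8) ∂gaussianReal 0 1

theorem integrable_exp_sq_div_gaussianReal :
    Integrable (fun x : ℝ => Real.exp (x ^ 2 / 8)) (gaussianReal 0 1) := by
  rw [gaussianReal_of_var_ne_zero 0 one_ne_zero,
    integrable_withDensity_iff_integrable_smul' (measurable_gaussianPDF 0 1)
      (ae_of_all _ fun _ => gaussianPDF_lt_top)]
  refine ((integrable_exp_neg_mul_sq (b := 3 / 8) (by norm_num)).const_mul
    (√(2 * Real.pi * (1 : ℝ≥0)))⁻¹).congr (ae_of_all _ fun x => ?_)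
  simp only [toReal_gaussianPDF, gaussianPDFReal, smul_eq_mul]
  rw [mul_assoc _ (Real.exp _), ← Real.exp_add]
  congr 2
  simp only [NNReal.coe_one]
  ring

theorem gaussSqExpMoment_nonneg : 0 ≤ gaussSqExpMoment :=
  integral_nonneg fun _ => (Real.exp_pos _).le

theorem integral_exp_sq_div_le {Ω : Type*} [MeasurableSpace Ω] {P : Measure Ω} {g : Ω → ℝ}
    {v : ℝ≥0} (hg : HasLaw g (gaussianReal 0 v) P) (hv : v ≤ 1) :
    Integrable (fun ω => Real.exp (g ω ^ 2 / 8)) P ∧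
      ∫ ω, Real.exp (g ω ^ 2 / 8) ∂P ≤ gaussSqExpMoment := by
  have hmap : (gaussianReal 0 1).map (fun x => √v * x) = gaussianReal 0 v := by
    rw [gaussianReal_map_const_mul]
    congr 1
    · simp
    · ext; simp
  have hle : ∀ x : ℝ, (√v * x) ^ 2 / 8 ≤ x ^ 2 / 8 := by
    intro x
    rw [mul_pow, Real.sq_sqrt v.coe_nonneg]
    have : (v : ℝ) ≤ 1 := by exact_mod_cast hv
    nlinarith [sq_nonneg x]
  have hI1 : Integrable (fun x : ℝ => Real.exp ((√v * x) ^ 2 / 8)) (gaussianReal 0 1) := by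
    refine integrable_exp_sq_div_gaussianReal.mono (by fun_prop) (ae_of_all _ fun x => ?_)
    rw [Real.norm_of_nonneg (by positivity), Real.norm_of_nonneg (by positivity)]
    exact Real.exp_le_exp.2 (hle x)
  have hI2 : Integrable (fun x : ℝ => Real.exp (x ^ 2 / 8)) (gaussianReal 0 v) := by
    rw [← hmap, integrable_map_measure (by fun_prop) (by fun_prop)]
    exact hI1
  constructor
  · rw [← hg.map_eq, integrable_map_measure (by fun_prop) hg.aemeasurable] at hI2
    exact hI2
  · calc ∫ ω, Real.exp (g ω ^ 2 / 8) ∂P = ∫ x, Real.exp (x ^ 2 / 8) ∂gaussianReal 0 v := by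
          rw [← hg.map_eq, integral_map hg.aemeasurable (by fun_prop)]
      _ = ∫ x, Real.exp ((√v * x) ^ 2 / 8) ∂gaussianReal 0 1 := by
          rw [← hmap, integral_map (by fun_prop) (by fun_prop)]
      _ ≤ _ := integral_mono hI1 integrable_exp_sq_div_gaussianReal fun x =>
          Real.exp_le_exp.2 (hle x)

section LinearForms

variable {Ω ι : Type*} [MeasurableSpace Ω] {P : Measure Ω} {g : ι → Ω → ℝ}

theorem covariance_of_iid (hlaw : ∀ p, HasLaw (g p) (gaussianReal 0 1) P) (hind : iIndepFun g P)
    [DecidableEq ι] (p q : ι) : cov[g p, g q; P] = if p = q then 1 else 0 := by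
  have hL2 : ∀ p, MemLp (g p) 2 P := fun p => (hlaw p).hasGaussianLaw.memLp_two
  split_ifs with h
  · subst h
    rw [covariance_self (hlaw p).aemeasurable]
    simpa using (hlaw p).variance_eq
  · exact (hind.indepFun h).covariance_eq_zero (hL2 p) (hL2 q)

theorem covariance_linearForm [IsProbabilityMeasure P] [Fintype ι]
    (hlaw : ∀ p, HasLaw (g p) (gaussianReal 0 1) P)
    (hind : iIndepFun g P) (c d : ι → ℝ) :
    cov[fun ω => ∑ p, c p * g p ω, fun ω => ∑ p, d p * g p ω; P] = ∑ p, c p * d p := by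
  classical
  have hL2 : ∀ p, MemLp (g p) 2 P := fun p => (hlaw p).hasGaussianLaw.memLp_two
  rw [covariance_fun_sum_fun_sum (fun p => (hL2 p).const_mul _) fun p => (hL2 p).const_mul _]
  refine Finset.sum_congr rfl fun p _ => ?_
  simp_rw [covariance_const_mul_left, covariance_const_mul_right, covariance_of_iid hlaw hind]
  simp

theorem integral_linearForm [Fintype ι]
    (hlaw : ∀ p, HasLaw (g p) (gaussianReal 0 1) P) (c : ι → ℝ) :
    ∫ ω, ∑ p, c p * g p ω ∂P = 0 := by
  rw [integral_finsetSum _ fun p _ => (hlaw p).hasGaussianLaw.integrable.const_mul _]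
  refine Finset.sum_eq_zero fun p _ => ?_
  rw [integral_const_mul, (hlaw p).integral_eq, integral_id_gaussianReal, mul_zero]

theorem hasGaussianLaw_linearForm [Fintype ι] (hlaw : ∀ p, HasLaw (g p) (gaussianReal 0 1) P)
    (hind : iIndepFun g P) (c : ι → ℝ) : HasGaussianLaw (fun ω => ∑ p, c p * g p ω) P := by
  refine iIndepFun.hasGaussianLaw_fun_sum (X := fun p ω => c p * g p ω)
    (fun p => by simpa using (hlaw p).hasGaussianLaw.fun_smul (c p)) ?_
  exact hind.comp (fun p x => c p * x) fun p => by fun_prop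

theorem hasLaw_linearForm [IsProbabilityMeasure P] [Fintype ι]
    (hlaw : ∀ p, HasLaw (g p) (gaussianReal 0 1) P)
    (hind : iIndepFun g P) (c : ι → ℝ) :
    HasLaw (fun ω => ∑ p, c p * g p ω) (gaussianReal 0 (∑ p, c p ^ 2).toNNReal) P := by
  have hG := hasGaussianLaw_linearForm hlaw hind c
  refine ⟨hG.aemeasurable, ?_⟩
  rw [hG.map_eq_gaussianReal, integral_linearForm hlaw, ← covariance_self hG.aemeasurable,
    covariance_linearForm hlaw hind]
  simp_rw [sq]

/-- Products of two linear forms of norm at most one in iid standard normal variables are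
subexponential, with expectation the inner product of the coefficient vectors. -/
theorem integral_exp_abs_mul_linearForm_le [IsProbabilityMeasure P] [Fintype ι]
    (hlaw : ∀ p, HasLaw (g p) (gaussianReal 0 1) P)
    (hind : iIndepFun g P) {c d : ι → ℝ} (hc : ∑ p, c p ^ 2 ≤ 1) (hd : ∑ p, d p ^ 2 ≤ 1) :
    Integrable (fun ω => Real.exp (|(∑ p, c p * g p ω) * ∑ p, d p * g p ω| / 8)) P ∧
      ∫ ω, Real.exp (|(∑ p, c p * g p ω) * ∑ p, d p * g p ω| / 8) ∂P ≤ gaussSqExpMoment ∧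
      ∫ ω, (∑ p, c p * g p ω) * ∑ p, d p * g p ω ∂P = ∑ p, c p * d p := by
  have hY := hasLaw_linearForm hlaw hind c
  have hB := hasLaw_linearForm hlaw hind d
  obtain ⟨hYi, hYM⟩ := integral_exp_sq_div_le hY (Real.toNNReal_le_one.2 hc)
  obtain ⟨hBi, hBM⟩ := integral_exp_sq_div_le hB (Real.toNNReal_le_one.2 hd)
  have hYm := hY.aemeasurable
  have hBm := hB.aemeasurable
  have hcov := covariance_linearForm hlaw hind c d
  rw [covariance_eq_sub hY.hasGaussianLaw.memLp_two hB.hasGaussianLaw.memLp_two,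
    integral_linearForm hlaw, integral_linearForm hlaw, mul_zero, sub_zero] at hcov
  set Y : Ω → ℝ := fun ω => ∑ p, c p * g p ω
  set B : Ω → ℝ := fun ω => ∑ p, d p * g p ω
  -- The inequality `2ab ≤ a² + b²`, used in the exponent and again on the exponentials, separates
  -- the two forms even though they are dependent.
  have hpt : ∀ ω, Real.exp (|Y ω * B ω| / 8) ≤
      (1 / 2) * Real.exp (Y ω ^ 2 / 8) + (1 / 2) * Real.exp (B ω ^ 2 / 8) := by
    intro ω
    have h1 : |Y ω * B ω| / 8 ≤ Y ω ^ 2 / 8 / 2 + B ω ^ 2 / 8 / 2 := by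
      rw [abs_mul]
      nlinarith [sq_nonneg (|Y ω| - |B ω|), sq_abs (Y ω), sq_abs (B ω)]
    refine (Real.exp_le_exp.2 h1).trans ?_
    have h2 : Real.exp (Y ω ^ 2 / 8) = Real.exp (Y ω ^ 2 / 8 / 2) ^ 2 := by
      rw [← Real.exp_nat_mul]; congr 1; push_cast; ring
    have h3 : Real.exp (B ω ^ 2 / 8) = Real.exp (B ω ^ 2 / 8 / 2) ^ 2 := by
      rw [← Real.exp_nat_mul]; congr 1; push_cast; ring
    rw [Real.exp_add, h2, h3]
    nlinarith [sq_nonneg (Real.exp (Y ω ^ 2 / 8 / 2) - Real.exp (B ω ^ 2 / 8 / 2))]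
  have hdom := (hYi.const_mul (1 / 2)).add (hBi.const_mul (1 / 2))
  have hI : Integrable (fun ω => Real.exp (|Y ω * B ω| / 8)) P := by
    refine hdom.mono (by fun_prop) (ae_of_all _ fun ω => ?_)
    rw [Real.norm_of_nonneg (by positivity)]
    exact (hpt ω).trans (le_abs_self _)
  refine ⟨hI, ?_, hcov⟩
  calc _ ≤ ∫ ω, ((1 / 2) * Real.exp (Y ω ^ 2 / 8) + (1 / 2) * Real.exp (B ω ^ 2 / 8)) ∂P :=
        integral_mono hI hdom hpt
    _ ≤ _ := by
        rw [integral_add (hYi.const_mul _) (hBi.const_mul _), integral_const_mul,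
          integral_const_mul]
        linarith

end LinearForms

/-- The blocks of a family of independent standard normal variables are independent. -/
theorem iIndepFun_blocks {Ω : Type*} [MeasurableSpace Ω] {P : Measure Ω} [IsProbabilityMeasure P]
    {ι κ : Type*} [Fintype ι] [Fintype κ] {g : ι → κ → Ω → ℝ}
    (hlaw : ∀ i p, HasLaw (g i p) (gaussianReal 0 1) P)
    (hind : iIndepFun (fun (q : ι × κ) ω => g q.1 q.2 ω) P) :
    iIndepFun (fun i ω p => g i p ω) P := by
  have hG : HasGaussianLaw (fun ω (q : ι × κ) => g q.1 q.2 ω) P :=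
    hind.hasGaussianLaw fun q => (hlaw q.1 q.2).hasGaussianLaw
  -- For a jointly Gaussian family, independence of blocks reduces to vanishing of the covariances
  -- across blocks.
  refine HasGaussianLaw.iIndepFun_of_covariance_eval ?_ fun i j hij k l => ?_
  · let Lm : ((ι × κ) → ℝ) →L[ℝ] (ι → κ → ℝ) :=
      ContinuousLinearMap.pi fun i => ContinuousLinearMap.pi fun p =>
        ContinuousLinearMap.proj (i, p)
    exact hG.map_fun Lm
  · have h : ((i, k) : ι × κ) ≠ (j, l) := fun h => hij (congrArg Prod.fst h)
    exact (hind.indepFun h).covariance_eq_zero (hlaw i k).hasGaussianLaw.memLp_two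
      (hlaw j l).hasGaussianLaw.memLp_two

/-- The constant in the exponent of the tail bound for the data matrix. -/
noncomputable def tailRate : ℝ := 1 / (2 * (16 + 1024 * gaussSqExpMoment))

theorem tailRate_pos : 0 < tailRate := by
  have := gaussSqExpMoment_nonneg
  unfold tailRate; positivity

theorem dotProduct_mulVec_eq_sum {n : ℕ} (B : Matrix (Fin n) (Fin n) ℝ) (v w : Fin n → ℝ) :
    v ⬝ᵥ (B *ᵥ w) = ∑ p : Fin n × Fin n, (v p.1 * w p.2) * B p.1 p.2 := by
  simp only [dotProduct, Matrix.mulVec, Fintype.sum_prod_type, Finset.mul_sum]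
  exact Finset.sum_congr rfl fun j _ => Finset.sum_congr rfl fun l _ => by ring

/-- Each summand is a product of two linear forms in the same Gaussian matrix, with coefficients `x
⊗ x` and the symmetric part of `v ⊗ w`. -/
theorem inner_symDataMatrix_mulVec {m n : ℕ} (hm : 0 < m)
    (A : Fin m → Matrix (Fin n) (Fin n) ℝ) (x w v : EuclideanSpace ℝ (Fin n)) :
    m * inner ℝ (WithLp.toLp 2 (symDataMatrix A (meas A x) *ᵥ w.ofLp)) v =
      ∑ i, (∑ p : Fin n × Fin n, (x p.1 * x p.2) * A i p.1 p.2) *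
        ∑ p : Fin n × Fin n, ((v p.1 * w p.2 + w p.1 * v p.2) / 2) * A i p.1 p.2 := by
  have hm' : (m : ℝ) ≠ 0 := by positivity
  have hB : ∀ i, ∑ p : Fin n × Fin n, ((v p.1 * w p.2 + w p.1 * v p.2) / 2) * A i p.1 p.2 =
      (v.ofLp ⬝ᵥ (A i *ᵥ w.ofLp) + w.ofLp ⬝ᵥ (A i *ᵥ v.ofLp)) / 2 := by
    intro i
    rw [dotProduct_mulVec_eq_sum, dotProduct_mulVec_eq_sum, ← Finset.sum_add_distrib,
      Finset.sum_div]
    exact Finset.sum_congr rfl fun p _ => by ring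
  have hD : ∀ a b : Fin n → ℝ, a ⬝ᵥ (dataMatrix A (meas A x) *ᵥ b) =
      (1 / m) * ∑ i, meas A x i * (a ⬝ᵥ (A i *ᵥ b)) := by
    intro a b
    simp only [dataMatrix, Matrix.smul_mulVec, Matrix.sum_mulVec, dotProduct_smul,
      dotProduct_sum, smul_eq_mul]
  have hS : inner ℝ (WithLp.toLp 2 (symDataMatrix A (meas A x) *ᵥ w.ofLp)) v =
      (v.ofLp ⬝ᵥ (dataMatrix A (meas A x) *ᵥ w.ofLp) +
        w.ofLp ⬝ᵥ (dataMatrix A (meas A x) *ᵥ v.ofLp)) / 2 := by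
    rw [EuclideanSpace.inner_eq_star_dotProduct]
    simp only [star_trivial, symDataMatrix, Matrix.smul_mulVec, Matrix.add_mulVec,
      dotProduct_smul, dotProduct_add, smul_eq_mul]
    rw [Matrix.mulVec_transpose, dotProduct_comm v.ofLp (w.ofLp ᵥ* _), ← Matrix.dotProduct_mulVec]
    ring
  rw [hS, hD, hD]
  simp_rw [hB, ← dotProduct_mulVec_eq_sum]
  rw [← mul_add, ← Finset.sum_add_distrib, mul_div_assoc, ← mul_assoc, mul_one_div_cancel hm',
    one_mul, Finset.sum_div]
  exact Finset.sum_congr rfl fun i _ => by simp only [meas]; ring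

theorem sum_sq_coord_eq_one {n : ℕ} {v : EuclideanSpace ℝ (Fin n)} (hv : ‖v‖ = 1) :
    ∑ j, v j ^ 2 = 1 := by
  rw [← EuclideanSpace.real_norm_sq_eq, hv, one_pow]

/-- Concentration of `⟪S̃ w, v⟫` about its expectation for fixed vectors `w` and `v`. -/
theorem tail_inner_symDataMatrix {Ω : Type*} [MeasurableSpace Ω] {P : Measure Ω}
    [IsProbabilityMeasure P] {m n : ℕ} {A : Fin m → Ω → Matrix (Fin n) (Fin n) ℝ}
    (hA : IsIIDGaussian P A) (hm : 0 < m) {x w v : EuclideanSpace ℝ (Fin n)}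
    (hx : ‖x‖ = 1) (hw : ‖w‖ = 1) (hv : ‖v‖ = 1) {t : ℝ} (ht : 0 ≤ t) :
    P.real {ω | t ≤ |inner ℝ (WithLp.toLp 2 (symDataMatrix (fun i => A i ω)
        (meas (fun i => A i ω) x) *ᵥ w.ofLp) - (inner ℝ x w : ℝ) • x) v|} ≤
      2 * Real.exp (-(tailRate * (m * min t (t ^ 2)))) := by
  have hm' : (0 : ℝ) < m := by positivity
  set c : Fin n × Fin n → ℝ := fun p => x p.1 * x p.2 with hc
  set d : Fin n × Fin n → ℝ := fun p => (v p.1 * w p.2 + w p.1 * v p.2) / 2 with hd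
  have hprod : ∀ a b : EuclideanSpace ℝ (Fin n), ‖a‖ = 1 → ‖b‖ = 1 →
      ∑ p : Fin n × Fin n, (a p.1 * b p.2) ^ 2 = 1 := by
    intro a b ha hb
    simp_rw [mul_pow, Fintype.sum_prod_type]
    rw [← Fintype.sum_mul_sum, sum_sq_coord_eq_one ha,
      sum_sq_coord_eq_one hb, one_mul]
  have hcsum : ∑ p, c p ^ 2 ≤ 1 := (hprod x x hx hx).le
  have hdsum : ∑ p, d p ^ 2 ≤ 1 := by
    calc ∑ p, d p ^ 2 ≤ ∑ p : Fin n × Fin n, ((v p.1 * w p.2) ^ 2 + (w p.1 * v p.2) ^ 2) / 2 :=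
          Finset.sum_le_sum fun p _ => by
            simp only [hd]; nlinarith [sq_nonneg (v p.1 * w p.2 - w p.1 * v p.2)]
      _ = 1 := by
          rw [← Finset.sum_div, Finset.sum_add_distrib, hprod v w hv hw, hprod w v hw hv]
          norm_num
  have hcd : ∑ p, c p * d p = inner ℝ x w * inner ℝ x v := by
    simp only [PiLp.inner_apply, RCLike.inner_apply, conj_trivial]
    rw [Finset.sum_mul_sum]
    calc ∑ p, c p * d p
        = (∑ p : Fin n × Fin n, (w p.1 * x p.1) * (v p.2 * x p.2) +
            ∑ p : Fin n × Fin n, (w p.2 * x p.2) * (v p.1 * x p.1)) / 2 := by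
          rw [← Finset.sum_add_distrib, Finset.sum_div]
          exact Finset.sum_congr rfl fun p _ => by simp only [hc, hd]; ring
      _ = _ := by
          rw [Fintype.sum_prod_type, Fintype.sum_prod_type_right]
          ring
  have hmain := fun i => integral_exp_abs_mul_linearForm_le
    (g := fun (p : Fin n × Fin n) ω => A i ω p.1 p.2) (fun p => hA.hasLaw i p.1 p.2)
    (hA.indep.precomp (g := fun p : Fin n × Fin n => (i, p)) (Prod.mk_right_injective i))
    hcsum hdsum
  have hblocks := iIndepFun_blocks (g := fun i (p : Fin n × Fin n) ω => A i ω p.1 p.2)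
    (fun i p => hA.hasLaw i p.1 p.2) hA.indep
  have hind : iIndepFun (fun i ω => (∑ p : Fin n × Fin n, c p * A i ω p.1 p.2) *
      ∑ p : Fin n × Fin n, d p * A i ω p.1 p.2) P :=
    hblocks.comp (fun _ a => (∑ p, c p * a p) * ∑ p, d p * a p) fun _ => by fun_prop
  have hmeas : ∀ i, AEMeasurable (fun ω => (∑ p : Fin n × Fin n, c p * A i ω p.1 p.2) *
      ∑ p : Fin n × Fin n, d p * A i ω p.1 p.2) P := by
    intro i
    have hAm : ∀ p : Fin n × Fin n, AEMeasurable (fun ω => A i ω p.1 p.2) P :=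
      fun p => (hA.hasLaw i p.1 p.2).aemeasurable
    fun_prop
  have hB := bernstein_tail hind hmeas (fun i => (hmain i).1) gaussSqExpMoment_nonneg
    (fun i => (hmain i).2.1) (fun i => (hmain i).2.2) ht
  have hexp : m * min t (t ^ 2) / (2 * (16 + 1024 * gaussSqExpMoment)) =
      tailRate * (m * min t (t ^ 2)) := by
    unfold tailRate; ring
  rw [hexp] at hB
  refine le_trans (measureReal_mono fun ω hω => ?_) hB
  simp only [Set.mem_ofPred_eq] at hω ⊢
  rw [hcd, ← inner_symDataMatrix_mulVec hm (fun i => A i ω) x w v, ← mul_sub, abs_mul,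
    abs_of_pos hm']
  rw [inner_sub_left, real_inner_smul_left] at hω
  gcongr

end QuadSystem

/-! ### Union bounds for the deviation and deterministic estimates. -/

namespace QuadSystem

/-- The deviation of `S̃ w` from its expectation `⟪x, w⟫ x`. -/
noncomputable def deviation {m n : ℕ} (A : Fin m → Matrix (Fin n) (Fin n) ℝ)
    (x w : EuclideanSpace ℝ (Fin n)) : EuclideanSpace ℝ (Fin n) :=
  WithLp.toLp 2 (symDataMatrix A (meas A x) *ᵥ w.ofLp) - (inner ℝ x w : ℝ) • x

/-- The threshold scales with `‖v‖`, which later produces an error proportional to `‖ŵ - x‖`. The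
strict inequality makes the event empty at `v = 0`. -/
theorem tail_inner_deviation {Ω : Type*} [MeasurableSpace Ω] {P : Measure Ω}
    [IsProbabilityMeasure P] {m n : ℕ} {A : Fin m → Ω → Matrix (Fin n) (Fin n) ℝ}
    (hA : IsIIDGaussian P A) (hm : 0 < m) {x w : EuclideanSpace ℝ (Fin n)}
    (hx : ‖x‖ = 1) (hw : ‖w‖ = 1) (v : EuclideanSpace ℝ (Fin n)) {t : ℝ} (ht : 0 ≤ t) :
    P.real {ω | t * ‖v‖ < |inner ℝ (deviation (fun i => A i ω) x w) v|} ≤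
      2 * Real.exp (-(tailRate * (m * min t (t ^ 2)))) := by
  rcases eq_or_ne v 0 with rfl | hv
  · simp only [norm_zero, mul_zero, inner_zero_right, abs_zero, lt_irrefl]
    simp only [Set.ofPred_false, measureReal_empty]
    positivity
  have hv0 : 0 < ‖v‖ := norm_pos_iff.2 hv
  refine le_trans (measureReal_mono fun ω hω => ?_)
    (tail_inner_symDataMatrix hA hm hx hw (v := ‖v‖⁻¹ • v) (norm_smul_inv_norm hv) ht)
  simp only [Set.mem_ofPred_eq] at hω ⊢
  rw [real_inner_smul_right, abs_mul, abs_of_pos (inv_pos.2 hv0), inv_mul_eq_div,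
    le_div_iff₀ hv0]
  exact hω.le

theorem tail_inner_deviation_finset {Ω : Type*} [MeasurableSpace Ω] {P : Measure Ω}
    [IsProbabilityMeasure P] {m n : ℕ} {A : Fin m → Ω → Matrix (Fin n) (Fin n) ℝ}
    (hA : IsIIDGaussian P A) (hm : 0 < m) {x w : EuclideanSpace ℝ (Fin n)}
    (hx : ‖x‖ = 1) (hw : ‖w‖ = 1) {β : Type*} (F : Finset β)
    (f : β → EuclideanSpace ℝ (Fin n)) {t : ℝ} (ht : 0 ≤ t) :
    P.real {ω | ∃ b ∈ F, t * ‖f b‖ < |inner ℝ (deviation (fun i => A i ω) x w) (f b)|} ≤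
      F.card * (2 * Real.exp (-(tailRate * (m * min t (t ^ 2))))) := by
  have hset : {ω | ∃ b ∈ F, t * ‖f b‖ < |inner ℝ (deviation (fun i => A i ω) x w) (f b)|} =
      ⋃ b ∈ F, {ω | t * ‖f b‖ < |inner ℝ (deviation (fun i => A i ω) x w) (f b)|} := by
    ext ω; simp
  rw [hset, ← nsmul_eq_mul]
  exact (measureReal_biUnion_finset_le _ _).trans
    (Finset.sum_le_card_nsmul _ _ _ fun b _ => tail_inner_deviation hA hm hx hw (f b) ht)

/-- The norm of a vector is controlled by its inner products with a `1/2`-net of the unit ball. -/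
theorem norm_le_of_inner_net_le {n : ℕ} {F : Finset (EuclideanSpace ℝ (Fin n))}
    (hF1 : ∀ c ∈ F, ‖c‖ ≤ 1)
    (hF : ∀ z : EuclideanSpace ℝ (Fin n), ‖z‖ ≤ 1 → ∃ c ∈ F, ‖z - c‖ ≤ 1 / 2)
    {e : EuclideanSpace ℝ (Fin n)} {t : ℝ} (ht : 0 ≤ t)
    (he : ∀ c ∈ F, |inner ℝ e c| ≤ t * ‖c‖) : ‖e‖ ≤ 2 * t := by
  rcases eq_or_ne e 0 with rfl | he0
  · simpa using ht
  obtain ⟨c, hc, hzc⟩ := hF (‖e‖⁻¹ • e) (norm_smul_inv_norm he0).le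
  have h1 : inner ℝ e (‖e‖⁻¹ • e) = ‖e‖ := by
    rw [real_inner_smul_right, real_inner_self_eq_norm_sq, sq, inv_mul_cancel_left₀]
    exact norm_ne_zero_iff.2 he0
  have h2 : inner ℝ e (‖e‖⁻¹ • e - c) ≤ ‖e‖ * (1 / 2) :=
    (real_inner_le_norm _ _).trans (by gcongr)
  rw [inner_sub_right, h1] at h2
  have h3 := (le_abs_self _).trans (he c hc)
  have h4 : t * ‖c‖ ≤ t := mul_le_of_le_one_right ht (hF1 c hc)
  linarith

/-- Optimality of the projection, for a model contained in the unit sphere. -/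
theorem sq_norm_sub_le_of_mem_projections {n : ℕ} {S : Set (EuclideanSpace ℝ (Fin n))}
    {z w x : EuclideanSpace ℝ (Fin n)} {c : ℝ} (hw : w ∈ projections S z) (hx : x ∈ S)
    (hw1 : ‖w‖ = 1) (hx1 : ‖x‖ = 1) : c * ‖w - x‖ ^ 2 / 2 ≤ inner ℝ (z - c • x) (w - x) := by
  -- With equal norms, minimality says `⟪z, x⟫ ≤ ⟪z, w⟫`, while `⟪x, w - x⟫ = -‖w - x‖² / 2`.
  have h := pow_le_pow_left₀ (norm_nonneg _) (hw.2 x hx) 2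
  rw [norm_sub_sq_real, norm_sub_sq_real, hw1, hx1] at h
  rw [norm_sub_sq_real, inner_sub_left, real_inner_smul_left, inner_sub_right, inner_sub_right,
    real_inner_self_eq_norm_sq, hw1, hx1, real_inner_comm]
  linarith

/-- If the bound fails, `c ≤ 1` forces `ε ≤ h`, so `D ε² ≤ D ε h` and a factor `h` cancels. -/
theorem le_div_mul_of_quadratic_le {c h ε B D : ℝ} (hc0 : 0 < c) (hc1 : c ≤ 1) (hh : 0 ≤ h)
    (hε : 0 ≤ ε) (hB : 0 ≤ B) (hD : 0 ≤ D) (hq : c * h ^ 2 / 2 ≤ B * ε * h + D * ε ^ 2) :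
    h ≤ 2 * (B + D + 1) / c * ε := by
  rw [div_mul_eq_mul_div, le_div_iff₀ hc0]
  by_contra! hcon
  have h1 : ε ≤ h := by
    have : h * c ≤ h := mul_le_of_le_one_right hh hc1
    nlinarith [mul_nonneg hB hε, mul_nonneg hD hε]
  have hh0 : 0 < h := by
    rcases hh.eq_or_lt with h0 | h0
    · rw [← h0] at hcon
      nlinarith [mul_nonneg hB hε, mul_nonneg hD hε]
    · exact h0
  have h2 := mul_lt_mul_of_pos_left hcon hh0
  have h3 : D * ε ^ 2 ≤ D * (ε * h) := by
    rw [sq]; gcongr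
  nlinarith [mul_nonneg hε hh]

end QuadSystem

/-! ### Choice of constants and proof of the theorem. -/

open QuadSystem

theorem theorem2 :
    -- `m = O(n)` with implied constant `K`; `Lrn` bounded away from `1` by `κ`
    ∀ K : ℝ, 0 < K → ∀ κ : ℝ, 1 < κ →
    ∃ C₁ C₂ C : ℝ, 0 < C₁ ∧ 0 < C₂ ∧ 0 < C ∧
    ∀ (m n k : ℕ) (L : ℝ≥0) (r : ℝ)
      (G : EuclideanSpace ℝ (Fin k) → EuclideanSpace ℝ (Fin n)),
      0 < r →
      LipschitzOnWith L G (Metric.closedBall 0 r) →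
      Set.MapsTo G (Metric.closedBall 0 r) (Metric.sphere 0 1) →
      κ ≤ L * r * n →
      (m : ℝ) ≤ K * n →
    ∀ (x w₀ : EuclideanSpace ℝ (Fin n)) (c₀ : ℝ),
      x ∈ G '' Metric.closedBall 0 r →
      ‖w₀‖ = 1 →
      0 < c₀ →
      c₀ < inner ℝ x w₀ →
      C₁ * (k * Real.log (L * r * n)) ≤ m →
    ∀ (Ω : Type*) [MeasurableSpace Ω] (P : Measure Ω) [IsProbabilityMeasure P]
      (A : Fin m → Ω → Matrix (Fin n) (Fin n) ℝ),
      QuadSystem.IsIIDGaussian P A →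
      1 - Real.exp (-(C₂ * (k * Real.log (L * r * n)))) ≤
        P.real {ω | ∀ w ∈ QuadSystem.powerStep (fun i => A i ω)
            (QuadSystem.meas (fun i => A i ω) x) G r w₀,
          ‖w - x‖ ≤ C / c₀ * Real.sqrt (k * Real.log (n * L * r) / m)} := by
  intro K hK κ hκ
  have hτ := tailRate_pos
  have hlam : 0 < Real.log κ := Real.log_pos hκ
  have hlog12 : 0 < Real.log 12 := Real.log_pos (by norm_num)
  have hlog20 : 0 < Real.log 20 := Real.log_pos (by norm_num)
  -- One `ℓ` pays for the `T ^ k` net points and one for the target probability; `log 12 / log κ`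
  -- absorbs the factor `12 ^ k`.
  set C₁ : ℝ := (2 + Real.log 12 / Real.log κ) / tailRate with hC₁
  have hC₁0 : 0 < C₁ := by positivity
  -- `K` puts `C' n / m` in the linear regime of Bernstein, `log 20` beats the net of the unit ball,
  -- and `K / C₁` covers `ℓ ≤ (K / C₁) n`.
  set C' : ℝ := K + (Real.log 20 + K / C₁) / tailRate with hC'
  have hC'0 : 0 < C' := by positivity
  set B : ℝ := √C₁ with hB
  have hB0 : 0 < B := Real.sqrt_pos.2 hC₁0
  -- Chosen so that `(K + 2 C') / m ≤ D ε²`, since `ℓ ≥ log κ`.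
  set D : ℝ := (K + 2 * C') / Real.log κ with hD
  have hD0 : 0 < D := by positivity
  refine ⟨C₁, 1, 2 * (B + D + 1), hC₁0, one_pos, by positivity, ?_⟩
  intro m n k L r G hr hL hG hT hmn x w₀ c₀ hxG hw₀ hc₀ hxw hm Ω _ P _ A hA
  have hcomm : (n : ℝ) * L * r = L * r * n := by ring
  rw [hcomm, one_mul]
  set T : ℝ := L * r * n with hTdef
  rcases Nat.eq_zero_or_pos k with hk | hk
  · subst hk
    simp only [Nat.cast_zero, zero_mul, neg_zero, Real.exp_zero, sub_self]
    exact measureReal_nonneg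
  have hk1 : (1 : ℝ) ≤ k := by exact_mod_cast hk
  have hT0 : 0 < T := by linarith
  have hlogT : Real.log κ ≤ Real.log T := Real.log_le_log (by linarith) hT
  set ℓ : ℝ := k * Real.log T with hℓ
  have hℓlam : Real.log κ ≤ ℓ :=
    hlogT.trans (le_mul_of_one_le_left (hlam.le.trans hlogT) hk1)
  have hℓ0 : 0 < ℓ := by linarith
  have hm0 : (0 : ℝ) < m := lt_of_lt_of_le (by positivity) hm
  have hmpos : 0 < m := by exact_mod_cast hm0
  have hn0 : (0 : ℝ) < n := (mul_pos_iff_of_pos_left hK).1 (hm0.trans_le hmn)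
  have hn1 : 1 ≤ n := by exact_mod_cast hn0
  have hL0 : (0 : ℝ) < L := by
    rcases L.coe_nonneg.eq_or_lt with h | h
    · rw [hTdef, ← h] at hT0; simp at hT0
    · exact h
  have hx1 : ‖x‖ = 1 := by
    obtain ⟨z, hz, rfl⟩ := hxG
    simpa using hG hz
  set ε : ℝ := √(ℓ / m) with hε
  have hε0 : 0 < ε := Real.sqrt_pos.2 (by positivity)
  have hεsq : ε ^ 2 = ℓ / m := Real.sq_sqrt (by positivity)
  have hBsq : B ^ 2 = C₁ := Real.sq_sqrt hC₁0.le
  have hBε0 : 0 ≤ B * ε := by positivity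
  have hBεsq : (B * ε) ^ 2 = C₁ * ℓ / m := by
    rw [mul_pow, hBsq, hεsq]; exact (mul_div_assoc _ _ _).symm
  have hBε1 : B * ε ≤ 1 := by
    have : (B * ε) ^ 2 ≤ 1 := by rw [hBεsq]; exact (div_le_one hm0).2 hm
    exact (sq_le_one_iff₀ hBε0).1 this
  -- the net of the parameter ball
  have hδ : (0 : ℝ) < 1 / (L * n) := by positivity
  obtain ⟨F, hFr, hFnet, hFcard⟩ := exists_net_closedBall (E := EuclideanSpace ℝ (Fin k)) hr hδ
  have hp1 := tail_inner_deviation_finset hA hmpos hx1 hw₀ F (fun z => x - G z) hBε0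
  have hp1' : P.real {ω | ∃ b ∈ F, B * ε * ‖x - G b‖ <
      |inner ℝ (deviation (fun i => A i ω) x w₀) (x - G b)|} ≤ Real.exp (-ℓ) / 2 := by
    refine hp1.trans ?_
    have hmin : min (B * ε) ((B * ε) ^ 2) = (B * ε) ^ 2 :=
      min_eq_right (pow_le_of_le_one hBε0 hBε1 two_ne_zero)
    rw [hmin, hBεsq, mul_div_cancel₀ _ hm0.ne']
    have hT1 : 1 + 2 * r / (1 / (L * n)) ≤ 3 * T := by
      have : 2 * r / (1 / (L * n)) = 2 * T := by rw [hTdef, div_div_eq_mul_div, div_one]; ring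
      linarith
    -- The `4` is the two-sided tail factor times the half share of the failure probability; `4 ≤ 4
    -- ^ k` because `k ≥ 1`.
    have hcard : 4 * (F.card : ℝ) ≤ Real.exp (k * Real.log 12 + ℓ) := by
      rw [finrank_euclideanSpace_fin] at hFcard
      calc 4 * (F.card : ℝ) ≤ 4 ^ k * (3 * T) ^ k := by
            gcongr
            · exact le_self_pow₀ (by norm_num) (by omega)
            · exact hFcard.trans (by gcongr)
        _ = (12 : ℝ) ^ k * T ^ k := by rw [← mul_pow, ← mul_pow]; ring
        _ = _ := by
          rw [Real.exp_add, hℓ, Real.exp_nat_mul, Real.exp_nat_mul, Real.exp_log hT0,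
            Real.exp_log (by norm_num)]
    have hk12 : k * Real.log 12 ≤ Real.log 12 / Real.log κ * ℓ := by
      rw [div_mul_eq_mul_div, le_div_iff₀ hlam, hℓ]
      have := mul_le_mul_of_nonneg_left hlogT (by positivity : 0 ≤ k * Real.log 12)
      linarith
    have hτC : tailRate * (C₁ * ℓ) = (2 + Real.log 12 / Real.log κ) * ℓ := by
      rw [hC₁]; field_simp
    have hfin : Real.exp (k * Real.log 12 + ℓ) * Real.exp (-(tailRate * (C₁ * ℓ))) ≤
        Real.exp (-ℓ) := by
      rw [← Real.exp_add, hτC]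
      exact Real.exp_le_exp.2 (by linarith)
    have := mul_le_mul_of_nonneg_right hcard (Real.exp_pos (-(tailRate * (C₁ * ℓ)))).le
    linarith
  -- the net of the unit ball
  obtain ⟨F', hF'1, hF'net, hF'card⟩ :=
    exists_net_closedBall (E := EuclideanSpace ℝ (Fin n)) (δ := 1 / 2) one_pos (by norm_num)
  have ht2 : 0 ≤ C' * n / m := by positivity
  have hp2 := tail_inner_deviation_finset hA hmpos hx1 hw₀ F' id ht2
  have hp2' : P.real {ω | ∃ b ∈ F', C' * n / m * ‖b‖ <
      |inner ℝ (deviation (fun i => A i ω) x w₀) b|} ≤ Real.exp (-ℓ) / 2 := by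
    refine hp2.trans ?_
    have hge : 1 ≤ C' * n / m := by
      rw [le_div_iff₀ hm0, one_mul]
      refine hmn.trans ?_
      gcongr
      rw [hC']
      exact le_add_of_nonneg_right (by positivity)
    rw [min_eq_left (le_self_pow₀ hge two_ne_zero), mul_div_cancel₀ _ hm0.ne']
    have hcard : 4 * (F'.card : ℝ) ≤ Real.exp (n * Real.log 20) := by
      rw [finrank_euclideanSpace_fin] at hF'card
      calc 4 * (F'.card : ℝ) ≤ 4 ^ n * 5 ^ n := by
            gcongr
            · exact le_self_pow₀ (by norm_num) (by omega)
            · norm_num at hF'card; exact hF'card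
        _ = (20 : ℝ) ^ n := by rw [← mul_pow]; norm_num
        _ = _ := by rw [Real.exp_nat_mul, Real.exp_log (by norm_num)]
    have hℓn : ℓ ≤ K / C₁ * n := by
      rw [div_mul_eq_mul_div, le_div_iff₀ hC₁0]; linarith
    have hτC : (Real.log 20 + K / C₁) * n ≤ tailRate * (C' * n) := by
      have : tailRate * (C' * n) = tailRate * K * n + (Real.log 20 + K / C₁) * n := by
        rw [hC']; field_simp
      rw [this]
      exact le_add_of_nonneg_left (by positivity)
    have hfin : Real.exp (n * Real.log 20) * Real.exp (-(tailRate * (C' * n))) ≤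
        Real.exp (-ℓ) := by
      rw [← Real.exp_add]
      exact Real.exp_le_exp.2 (by linarith)
    have := mul_le_mul_of_nonneg_right hcard (Real.exp_pos (-(tailRate * (C' * n)))).le
    linarith
  -- the deterministic argument off the exceptional events
  set E₁ : Set Ω := {ω | ∃ b ∈ F, B * ε * ‖x - G b‖ <
      |inner ℝ (deviation (fun i => A i ω) x w₀) (x - G b)|} with hE₁
  set E₂ : Set Ω := {ω | ∃ b ∈ F', C' * n / m * ‖b‖ <
      |inner ℝ (deviation (fun i => A i ω) x w₀) b|} with hE₂
  set S : Set Ω := {ω | ∀ w ∈ powerStep (fun i => A i ω) (meas (fun i => A i ω) x) G r w₀,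
    ‖w - x‖ ≤ 2 * (B + D + 1) / c₀ * ε} with hS
  have hcover : Set.univ ⊆ S ∪ (E₁ ∪ E₂) := by
    intro ω _
    by_cases h1 : ω ∈ E₁
    · exact Or.inr (Or.inl h1)
    by_cases h2 : ω ∈ E₂
    · exact Or.inr (Or.inr h2)
    left
    simp only [hE₁, hE₂, Set.mem_ofPred_eq, not_exists, not_and, not_lt] at h1 h2
    intro w hw
    have hw1 : ‖w‖ = 1 := by
      obtain ⟨z, hz, rfl⟩ := hw.1
      simpa using hG hz
    set e := deviation (fun i => A i ω) x w₀ with he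
    have henorm : ‖e‖ ≤ 2 * (C' * n / m) := norm_le_of_inner_net_le hF'1 hF'net ht2 h2
    have hopt : inner ℝ x w₀ * ‖w - x‖ ^ 2 / 2 ≤ inner ℝ e (w - x) :=
      sq_norm_sub_le_of_mem_projections hw hxG hw1 hx1
    obtain ⟨z, hz, hzw⟩ := hw.1
    obtain ⟨z', hz', hzz'⟩ := hFnet z (by simpa using hz)
    have hww' : ‖w - G z'‖ ≤ 1 / n := by
      rw [← hzw]
      refine (hL.norm_sub_le hz (by simpa using hFr z' hz')).trans ?_
      calc (L : ℝ) * ‖z - z'‖ ≤ L * (1 / (L * n)) := by gcongr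
        _ = 1 / n := by field_simp
    have hsplit : inner ℝ e (w - x) = inner ℝ e (w - G z') - inner ℝ e (x - G z') := by
      rw [← inner_sub_right]; congr 1; abel
    have hA1 : inner ℝ e (w - G z') ≤ 2 * C' / m := by
      refine (real_inner_le_norm _ _).trans ?_
      calc ‖e‖ * ‖w - G z'‖ ≤ 2 * (C' * n / m) * (1 / n) := by gcongr
        _ = 2 * C' / m := by field_simp
    -- Here `B ε ≤ 1`, and `m ≤ K n` turns the mesh `1/n` into `K/m`.
    have hA2 : -inner ℝ e (x - G z') ≤ B * ε * ‖w - x‖ + K / m := by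
      refine (neg_le_abs _).trans ((h1 z' hz').trans ?_)
      have htri : ‖x - G z'‖ ≤ ‖w - x‖ + 1 / n := by
        calc ‖x - G z'‖ = ‖(w - G z') - (w - x)‖ := by congr 1; abel
          _ ≤ ‖w - G z'‖ + ‖w - x‖ := norm_sub_le _ _
          _ ≤ _ := by linarith
      have hnm : 1 / (n : ℝ) ≤ K / m := by
        rw [div_le_div_iff₀ hn0 hm0]; linarith
      calc B * ε * ‖x - G z'‖ ≤ B * ε * (‖w - x‖ + 1 / n) := by gcongr
        _ = B * ε * ‖w - x‖ + B * ε * (1 / n) := by ring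
        _ ≤ B * ε * ‖w - x‖ + 1 * (K / m) := by gcongr
        _ = _ := by rw [one_mul]
    have hDε : 2 * C' / m + K / m ≤ D * ε ^ 2 := by
      rw [hεsq, hD, ← add_div, div_mul_div_comm, div_le_div_iff₀ hm0 (by positivity)]
      have : (2 * C' + K) * m * Real.log κ ≤ (2 * C' + K) * m * ℓ := by gcongr
      linarith
    have hc₀1 : c₀ ≤ 1 := by
      have := real_inner_le_norm x w₀
      rw [hx1, hw₀] at this
      linarith
    refine le_div_mul_of_quadratic_le hc₀ hc₀1 (norm_nonneg _) hε0.le hB0.le hD0.le ?_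
    have hmono : c₀ * ‖w - x‖ ^ 2 ≤ inner ℝ x w₀ * ‖w - x‖ ^ 2 := by gcongr
    linarith
  -- Subadditivity over a cover, rather than complements, so no measurability of the events is
  -- needed.
  have hprob : P.real Set.univ ≤ P.real S + (P.real E₁ + P.real E₂) :=
    (measureReal_mono hcover).trans ((measureReal_union_le _ _).trans
      (add_le_add le_rfl (measureReal_union_le _ _)))
  rw [probReal_univ] at hprob
  linarith
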